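/- Let $\Omega\subseteq\mathbb R^2$ be an open subset of the $(t,x)$-plane. A subset $U$ of the $(t,x)$-plane is called $x$-simple if, for every $t\in\mathbb R$, the section $U_t=\{x\in\mathbb R: (t,x)\in U\}$ is an open interval (bounded or unbounded) or empty. Let $C(\Omega)$ be the real vector space of continuous functions $\Omega\to\mathbb R$, and for an integer $p\ge1$ let $C^p_x(\Omega)\subseteq C(\Omega)$ be the subspace of functions $u$ whose partial derivatives $u_i=\partial^i u/\partial x^i$, $0\le i\le p$, exist and are continuous on $\Omega$. Let $\mathrm{DO}(\Omega)$ be the set of operators $$P=\sum_{i=0}^p g^i(t,x)\,\partial_x^i\colon\ C^p_x(\Omega)\to C(\Omega),\qquad p\ge 1,$$ with coefficients $g^0,\dots,g^p\in C(\Omega)$ and with $g^p(t,x)\neq0$ for all $(t,x)\in\Omega$. If some connected component of $\Omega$ is not $x$-simple, then for every $P\in\mathrm{DO}(\Omega)$ the quotient space $C(\Omega)/\operatorname{im}P$ is infinite-dimensional. -/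

import Mathlib

noncomputable section

namespace ParamODE

/-- The section `U_t = {x | (t, x) ∈ U}` of a subset of the `(t,x)`-plane. -/
def xSection (U : Set (ℝ × ℝ)) (t : ℝ) : Set ℝ := {x | (t, x) ∈ U}

/-- A subset of the `(t,x)`-plane is `x`-simple if each of its sections by a line `t = const` is
an open interval (bounded or not) or empty, that is, an open and order-connected subset of `ℝ`. -/
def IsXSimple (U : Set (ℝ × ℝ)) : Prop :=
  ∀ t : ℝ, IsOpen (xSection U t) ∧ (xSection U t).OrdConnected

variable {Ω : Set (ℝ × ℝ)}

open Classical in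
/-- The function `x ↦ u(t, x)` on the section `Ω_t`, extended by zero outside `Ω_t`. For open `Ω`
its derivatives at points of `Ω_t` do not depend on the extension. -/
def slice (u : C(Ω, ℝ)) (t : ℝ) : ℝ → ℝ :=
  fun x => if h : (t, x) ∈ Ω then u ⟨(t, x), h⟩ else 0

/-- The value `u_i(z)` of the `i`-th partial derivative of `u` with respect to `x`. -/
def xDerivAt (i : ℕ) (u : C(Ω, ℝ)) (z : Ω) : ℝ :=
  iteratedDeriv i (slice u z.1.1) z.1.2

lemma slice_add (u v : C(Ω, ℝ)) (t : ℝ) : slice (u + v) t = slice u t + slice v t := by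
  funext x
  by_cases h : (t, x) ∈ Ω <;> simp [slice, h]

lemma slice_smul (c : ℝ) (u : C(Ω, ℝ)) (t : ℝ) : slice (c • u) t = c • slice u t := by
  funext x
  by_cases h : (t, x) ∈ Ω <;> simp [slice, h]

lemma slice_zero (t : ℝ) : slice (0 : C(Ω, ℝ)) t = fun _ => 0 := by
  funext x
  by_cases h : (t, x) ∈ Ω <;> simp [slice, h]

lemma xDerivAt_add {i p : ℕ} (hi : i ≤ p) {u v : C(Ω, ℝ)} (z : Ω)
    (hu : ContDiffAt ℝ p (slice u z.1.1) z.1.2) (hv : ContDiffAt ℝ p (slice v z.1.1) z.1.2) :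
    xDerivAt i (u + v) z = xDerivAt i u z + xDerivAt i v z := by
  unfold xDerivAt
  rw [slice_add]
  exact iteratedDeriv_add (hu.of_le (by exact_mod_cast hi)) (hv.of_le (by exact_mod_cast hi))

lemma xDerivAt_smul {i p : ℕ} (hi : i ≤ p) (c : ℝ) {u : C(Ω, ℝ)} (z : Ω)
    (hu : ContDiffAt ℝ p (slice u z.1.1) z.1.2) :
    xDerivAt i (c • u) z = c * xDerivAt i u z := by
  unfold xDerivAt
  rw [slice_smul]
  exact iteratedDeriv_const_smul (n := i) (hu.of_le (by exact_mod_cast hi)) c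

/-- The space `C^p_x(Ω)` of the functions from `C(Ω)` that admit derivatives with respect to `x` up
to order `p` which are continuous on `Ω` (as functions of `(t,x)`). -/
def Cx (p : ℕ) (Ω : Set (ℝ × ℝ)) : Submodule ℝ C(Ω, ℝ) where
  carrier := {u | (∀ z : Ω, ContDiffAt ℝ p (slice u z.1.1) z.1.2) ∧
    ∀ i ≤ p, Continuous (xDerivAt i u)}
  add_mem' := by
    rintro u v ⟨hu, hu'⟩ ⟨hv, hv'⟩
    refine ⟨fun z => ?_, fun i hi => ?_⟩
    · rw [slice_add]
      exact (hu z).add (hv z)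
    · rw [show xDerivAt i (u + v) = fun z => xDerivAt i u z + xDerivAt i v z from
        funext fun z => xDerivAt_add hi z (hu z) (hv z)]
      exact (hu' i hi).add (hv' i hi)
  zero_mem' := by
    refine ⟨fun z => ?_, fun i _ => ?_⟩
    · rw [slice_zero]
      exact contDiffAt_const
    · have : xDerivAt i (0 : C(Ω, ℝ)) = fun _ => 0 := by
        funext z
        simp [xDerivAt, slice_zero]
      rw [this]
      exact continuous_const
  smul_mem' := by
    rintro c u ⟨hu, hu'⟩
    refine ⟨fun z => ?_, fun i hi => ?_⟩
    · rw [slice_smul]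
      exact (hu z).const_smul c
    · rw [show xDerivAt i (c • u) = fun z => c * xDerivAt i u z from
        funext fun z => xDerivAt_smul hi c z (hu z)]
      exact continuous_const.mul (hu' i hi)

/-- The operator `u ↦ u_i = ∂^i u / ∂x^i` from `C^p_x(Ω)` to `C(Ω)`, for `0 ≤ i ≤ p`. -/
def xDeriv {p : ℕ} (i : Fin (p + 1)) : Cx p Ω →ₗ[ℝ] C(Ω, ℝ) where
  toFun u := ⟨xDerivAt i u.1, u.2.2 i (Nat.lt_succ_iff.mp i.2)⟩
  map_add' u v := by
    ext z
    exact xDerivAt_add (Nat.lt_succ_iff.mp i.2) z (u.2.1 z) (v.2.1 z)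
  map_smul' c u := by
    ext z
    exact xDerivAt_smul (Nat.lt_succ_iff.mp i.2) c z (u.2.1 z)

/-- `DO(Ω)`: linear differential operators `P = ∑_{i=0}^p g^i ∂_x^i` with coefficients
`g^i ∈ C(Ω)` whose leading coefficient `g^p` vanishes nowhere on `Ω`. -/
structure DO (Ω : Set (ℝ × ℝ)) where
  ord : ℕ
  coeff : Fin (ord + 1) → C(Ω, ℝ)
  lcoef_ne_zero : ∀ z : Ω, coeff (Fin.last ord) z ≠ 0

/-- The operator `P` as a linear map `C^p_x(Ω) → C(Ω)`, `u ↦ ∑_{i=0}^p g^i u_i`, `p = ord P`. -/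
def DO.toLinearMap (P : DO Ω) : Cx P.ord Ω →ₗ[ℝ] C(Ω, ℝ) :=
  ∑ i : Fin (P.ord + 1), LinearMap.mulLeft ℝ (P.coeff i) ∘ₗ xDeriv i

end ParamODE

end

noncomputable section

namespace ParamODE

open Set Filter Topology

/-! ### Sections of plane domains -/

/-! If a component is not `x`-simple, then some vertical segments `{s} × [a, b]` in `Ω`, with `s →
t` and `s ≠ t`, converge to a segment whose endpoints lie in `Ω` but which misses `Ω` at an inner
point `(t, c)` (`exists_vertical_gap`). Along a sequence of such `s = τ n`, place a small bump with
amplitude `α n` at `(τ n, c)`. The bumps accumulate only at `(t, c) ∉ Ω`, so every sequence `α`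
gives a continuous function `F` on `Ω`.

Suppose that `P u = gᵖ F`. On the `n`-th segment the jet of `u` solves a linear system driven by one
bump. Gronwall estimates bound `|α n|` by a factor depending on `n` but not on `α`, times the size
of the jets at the two ends (`abs_mul_integral_le`). These jets stay bounded as `n → ∞`, since `(t,
a)` and `(t, b)` lie in `Ω`. Hence solvability limits the growth of `α`
(`DO.exists_linearMap_growth`), and an infinite-dimensional space of sequences whose nonzero members
all grow faster injects into the quotient. -/

/-- The points `(t, a)` and `(t, b)` are joined by a vertical segment inside `Ω`. -/
def VJoined (Ω : Set (ℝ × ℝ)) (t a b : ℝ) : Prop := ∀ c ∈ uIcc a b, (t, c) ∈ Ω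

lemma VJoined.symm {Ω : Set (ℝ × ℝ)} {t a b : ℝ} (h : VJoined Ω t a b) : VJoined Ω t b a :=
  fun c hc => h c (by rwa [uIcc_comm])

lemma VJoined.trans {Ω : Set (ℝ × ℝ)} {t a b c : ℝ} (h : VJoined Ω t a b)
    (h' : VJoined Ω t b c) : VJoined Ω t a c := fun x hx =>
  (uIcc_subset_uIcc_union_uIcc hx).elim (h x) (h' x)

lemma VJoined.eventually {Ω : Set (ℝ × ℝ)} (hΩ : IsOpen Ω) {t a b : ℝ} (h : VJoined Ω t a b) :
    ∀ᶠ s in 𝓝 t, VJoined Ω s a b := by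
  obtain ⟨u, v, hu, -, htu, hv, huv⟩ := generalized_tube_lemma (isCompact_singleton (x := t))
    (isCompact_uIcc (a := a) (b := b)) hΩ (by rintro ⟨s, x⟩ ⟨rfl, hx⟩; exact h x hx)
  filter_upwards [hu.mem_nhds (htu rfl)] with s hs c hc
  exact huv ⟨hs, hv hc⟩

lemma eventually_mk_mem {W : Set (ℝ × ℝ)} (hW : IsOpen W) {t a : ℝ} (h : (t, a) ∈ W) :
    ∀ᶠ s in 𝓝 t, (s, a) ∈ W :=
  (hW.preimage (Continuous.prodMk_left a)).mem_nhds h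

/-- An open connected subset of `Ω` any two points of which that lie on a common vertical line are
joined by a vertical segment inside `Ω`. -/
structure IsTube (Ω W : Set (ℝ × ℝ)) : Prop where
  isOpen : IsOpen W
  isPreconnected : IsPreconnected W
  joined : ∀ ⦃t a b : ℝ⦄, (t, a) ∈ W → (t, b) ∈ W → VJoined Ω t a b

/-- Vertical segments in `Ω` with endpoints varying along horizontal lines in `Ω` may only converge
to segments in `Ω`. -/
def IsVSeparated (Ω : Set (ℝ × ℝ)) : Prop :=
  ∀ t a b : ℝ, (t, a) ∈ Ω → (t, b) ∈ Ω → (∃ᶠ s in 𝓝 t, VJoined Ω s a b) → VJoined Ω t a b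

lemma IsTube.subset {Ω W : Set (ℝ × ℝ)} (hW : IsTube Ω W) : W ⊆ Ω :=
  fun _ hz => hW.joined hz hz _ left_mem_uIcc

lemma exists_isTube_mem {Ω : Set (ℝ × ℝ)} (hΩ : IsOpen Ω) {z : ℝ × ℝ} (hz : z ∈ Ω) :
    ∃ W, IsTube Ω W ∧ z ∈ W := by
  obtain ⟨ε, hε, hb⟩ := Metric.isOpen_iff.1 hΩ z hz
  refine ⟨Metric.ball z ε, ⟨Metric.isOpen_ball, (convex_ball z ε).isPreconnected, ?_⟩,
    Metric.mem_ball_self hε⟩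
  intro t a b ha hb' c hc
  apply hb
  rw [← ball_prod_same, mem_prod] at ha hb' ⊢
  refine ⟨ha.1, ?_⟩
  have : (Metric.ball z.2 ε).OrdConnected := (convex_ball z.2 ε).ordConnected
  exact this.uIcc_subset ha.2 hb'.2 hc

/-- The abscissas over which `W` and `W'` are joined form an open set `T`. By vertical separation
`T` is relatively closed in the intersection of the two projections. That intersection is an
interval, and it meets `T` because `W` meets `W'`, so it lies in `T`. -/
lemma IsTube.union {Ω W W' : Set (ℝ × ℝ)} (hΩ : IsOpen Ω) (hsep : IsVSeparated Ω)
    (hW : IsTube Ω W) (hW' : IsTube Ω W') (hne : (W ∩ W').Nonempty) : IsTube Ω (W ∪ W') := by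
  set T : Set ℝ := {t | ∃ a b, (t, a) ∈ W ∧ (t, b) ∈ W' ∧ VJoined Ω t a b} with hT
  have hall : ∀ t ∈ T, ∀ a b, (t, a) ∈ W → (t, b) ∈ W' → VJoined Ω t a b := by
    rintro t ⟨a', b', ha', hb', h⟩ a b ha hb
    exact ((hW.joined ha ha').trans h).trans (hW'.joined hb' hb)
  have hTo : IsOpen T := by
    rw [isOpen_iff_mem_nhds]
    rintro t ⟨a, b, ha, hb, h⟩
    filter_upwards [eventually_mk_mem hW.isOpen ha, eventually_mk_mem hW'.isOpen hb,
      h.eventually hΩ] with s h1 h2 h3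
    exact ⟨a, b, h1, h2, h3⟩
  have hI : IsPreconnected (Prod.fst '' W ∩ Prod.fst '' W') :=
    (((hW.isPreconnected.image _ continuous_fst.continuousOn).ordConnected).inter
      ((hW'.isPreconnected.image _ continuous_fst.continuousOn).ordConnected)).isPreconnected
  have hsub : Prod.fst '' W ∩ Prod.fst '' W' ⊆ T := by
    refine hI.subset_of_closure_inter_subset hTo ?_ ?_
    · obtain ⟨⟨t, a⟩, h, h'⟩ := hne
      exact ⟨t, ⟨⟨_, h, rfl⟩, ⟨_, h', rfl⟩⟩, a, a, h, h', hW.joined h h⟩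
    · rintro t ⟨htc, ⟨⟨_, a⟩, ha, rfl⟩, ⟨⟨s, b⟩, hb, hs⟩⟩
      obtain rfl : s = _ := hs
      refine ⟨a, b, ha, hb, hsep _ _ _ (hW.subset ha) (hW'.subset hb) ?_⟩
      refine ((mem_closure_iff_frequently.1 htc).and_eventually
        ((eventually_mk_mem hW.isOpen ha).and (eventually_mk_mem hW'.isOpen hb))).mono ?_
      rintro s ⟨h1, h2, h3⟩
      exact hall s h1 a b h2 h3
  refine ⟨hW.isOpen.union hW'.isOpen, hW.isPreconnected.union' hne hW'.isPreconnected, ?_⟩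
  rintro t a b (ha | ha) (hb | hb)
  · exact hW.joined ha hb
  · exact hall t (hsub ⟨⟨_, ha, rfl⟩, ⟨_, hb, rfl⟩⟩) a b ha hb
  · exact (hall t (hsub ⟨⟨_, hb, rfl⟩, ⟨_, ha, rfl⟩⟩) b a hb ha).symm
  · exact hW'.joined ha hb

/-- The connected components of a vertically separated open set are `x`-simple. -/
lemma IsVSeparated.isXSimple {Ω : Set (ℝ × ℝ)} (hΩ : IsOpen Ω) (hsep : IsVSeparated Ω)
    {z : ℝ × ℝ} (hz : z ∈ Ω) : IsXSimple (connectedComponentIn Ω z) := by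
  set c : Set (Set (ℝ × ℝ)) := {W | IsTube Ω W ∧ z ∈ W} with hc
  have hM : IsTube Ω (⋃₀ c) := by
    refine ⟨isOpen_sUnion fun W hW => hW.1.isOpen,
      isPreconnected_sUnion z c (fun W hW => hW.2) fun W hW => hW.1.isPreconnected, ?_⟩
    rintro t a b ⟨W, hW, ha⟩ ⟨W', hW', hb⟩
    exact (hW.1.union hΩ hsep hW'.1 ⟨z, hW.2, hW'.2⟩).joined (Or.inl ha) (Or.inr hb)
  have hzM : z ∈ ⋃₀ c := by
    obtain ⟨W, hW, hzW⟩ := exists_isTube_mem hΩ hz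
    exact ⟨W, ⟨hW, hzW⟩, hzW⟩
  -- The union of all tubes through `z` is the largest one. A small ball about a limit point of it
  -- in the component could be adjoined, so it is relatively clopen there.
  have hsub : connectedComponentIn Ω z ⊆ ⋃₀ c := by
    refine isPreconnected_connectedComponentIn.subset_of_closure_inter_subset hM.isOpen
      ⟨z, mem_connectedComponentIn hz, hzM⟩ ?_
    rintro w ⟨hwc, hw⟩
    obtain ⟨V, hV, hwV⟩ := exists_isTube_mem hΩ (connectedComponentIn_subset _ _ hw)
    have hne : (⋃₀ c ∩ V).Nonempty := by
      rw [inter_comm]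
      exact mem_closure_iff.1 hwc V hV.isOpen hwV
    exact ⟨_, ⟨hM.union hΩ hsep hV hne, Or.inl hzM⟩, Or.inr hwV⟩
  intro t
  refine ⟨hΩ.connectedComponentIn.preimage (Continuous.prodMk_right t), ⟨?_⟩⟩
  intro a ha b hb x hx
  have hj := hM.joined (hsub ha) (hsub hb)
  have hpre : IsPreconnected ((fun y : ℝ => (t, y)) '' uIcc a b) :=
    isPreconnected_uIcc.image _ (Continuous.prodMk_right t).continuousOn
  have hs := hpre.subset_connectedComponentIn (F := Ω) ⟨a, left_mem_uIcc, rfl⟩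
    (by rintro _ ⟨y, hy, rfl⟩; exact hj y hy)
  rw [← connectedComponentIn_eq ha] at hs
  exact hs ⟨x, Icc_subset_uIcc hx, rfl⟩

/-- If some component of `Ω` is not `x`-simple, there are vertical segments in `Ω` converging to a
segment with endpoints in `Ω` that leaves `Ω`. -/
lemma exists_vertical_gap {Ω : Set (ℝ × ℝ)} (hΩ : IsOpen Ω)
    (h : ∃ z ∈ Ω, ¬ IsXSimple (connectedComponentIn Ω z)) :
    ∃ t a b c : ℝ, a < c ∧ c < b ∧ (t, a) ∈ Ω ∧ (t, b) ∈ Ω ∧ (t, c) ∉ Ω ∧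
      ∃ᶠ s in 𝓝[≠] t, ∀ x ∈ Icc a b, (s, x) ∈ Ω := by
  obtain ⟨z, hz, hns⟩ := h
  have hsep : ¬ IsVSeparated Ω := fun hsep => hns (hsep.isXSimple hΩ hz)
  have key : ∃ t a b : ℝ, a ≤ b ∧ (t, a) ∈ Ω ∧ (t, b) ∈ Ω ∧ (∃ᶠ s in 𝓝 t, VJoined Ω s a b) ∧
      ¬ VJoined Ω t a b := by
    unfold IsVSeparated at hsep
    push Not at hsep
    obtain ⟨t, a, b, ha, hb, hf, hn⟩ := hsep
    rcases le_total a b with hab | hab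
    · exact ⟨t, a, b, hab, ha, hb, hf, hn⟩
    · exact ⟨t, b, a, hab, hb, ha, hf.mono fun s hs => hs.symm, fun h => hn h.symm⟩
  obtain ⟨t, a, b, hab, ha, hb, hf, hn⟩ := key
  unfold VJoined at hn
  push Not at hn
  obtain ⟨c, hc, hcn⟩ := hn
  rw [uIcc_of_le hab] at hc
  refine ⟨t, a, b, c, lt_of_le_of_ne hc.1 ?_, lt_of_le_of_ne hc.2 ?_, ha, hb, hcn, ?_⟩
  · rintro rfl; exact hcn ha
  · rintro rfl; exact hcn hb
  -- The condition `s ≠ t` is automatic: the section at `t` misses `c`.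
  · rw [frequently_nhdsWithin_iff]
    refine hf.mono fun s hs => ⟨fun x hx => hs x (Icc_subset_uIcc hx), ?_⟩
    rintro rfl
    exact hcn (hs c (Icc_subset_uIcc hc))

/-! ### Estimates for linear systems -/

section Estimates

variable {E : Type*} [NormedAddCommGroup E] [NormedSpace ℝ E]

lemma norm_le_exp_of_norm_deriv_le {Y Y' : ℝ → E} {a b K : ℝ}
    (hY : ∀ x ∈ Icc a b, HasDerivAt Y (Y' x) x) (hK : ∀ x ∈ Icc a b, ‖Y' x‖ ≤ K * ‖Y x‖)
    (hab : a ≤ b) : ‖Y b‖ ≤ ‖Y a‖ * Real.exp (K * (b - a)) := by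
  have := norm_le_gronwallBound_of_norm_deriv_right_le (f := Y) (f' := Y') (δ := ‖Y a‖) (K := K)
    (ε := 0) (a := a) (b := b) (fun x hx => (hY x hx).continuousAt.continuousWithinAt)
    (fun x hx => (hY x (Ico_subset_Icc_self hx)).hasDerivWithinAt) le_rfl
    (fun x hx => by simpa using hK x (Ico_subset_Icc_self hx)) b (right_mem_Icc.2 hab)
  rwa [gronwallBound_ε0] at this

/-- The reflection `x ↦ -x` reduces this to the forward estimate. -/
lemma norm_le_exp_of_norm_deriv_le_reverse {Y Y' : ℝ → E} {a b K : ℝ}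
    (hY : ∀ x ∈ Icc a b, HasDerivAt Y (Y' x) x) (hK : ∀ x ∈ Icc a b, ‖Y' x‖ ≤ K * ‖Y x‖)
    (hab : a ≤ b) : ‖Y a‖ ≤ ‖Y b‖ * Real.exp (K * (b - a)) := by
  have hm : ∀ x ∈ Icc (-b) (-a), -x ∈ Icc a b := fun x hx =>
    ⟨by linarith [hx.2], by linarith [hx.1]⟩
  have := norm_le_exp_of_norm_deriv_le (Y := fun x => Y (-x)) (Y' := fun x => -Y' (-x)) (K := K)
    (a := -b) (b := -a)
    (fun x hx => by
      simpa [Function.comp_def] using (hY (-x) (hm x hx)).scomp x (hasDerivAt_neg x))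
    (fun x hx => by simpa using hK (-x) (hm x hx)) (by linarith)
  simp only [neg_neg] at this
  convert this using 3
  ring

/-- A solution of a linear system driven by a bump `A β` on a short interval controls the
amplitude `A` by its values at the two ends. -/
lemma abs_mul_integral_le_of_short {Y Y' : ℝ → E} {e : E} (he : ‖e‖ = 1) {β : ℝ → ℝ}
    (hβ : Continuous β) (hβ0 : ∀ x, 0 ≤ β x) {A K l r : ℝ} (hlr : l ≤ r) (hK0 : 0 ≤ K)
    (hsmall : K * (r - l) ≤ 1 / 4)
    (hY : ∀ x ∈ Icc l r, HasDerivAt Y (Y' x) x)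
    (hK : ∀ x ∈ Icc l r, ‖Y' x - (A * β x) • e‖ ≤ K * ‖Y x‖) :
    |A| * (∫ x in l..r, β x) ≤ 2 * (‖Y l‖ + ‖Y r‖) := by
  set B : ℝ → ℝ := fun x => ∫ y in l..x, β y with hB
  have hBd : ∀ x, HasDerivAt B (β x) x := fun x =>
    intervalIntegral.integral_hasDerivAt_right (hβ.intervalIntegrable _ _)
      (hβ.stronglyMeasurableAtFilter _ _) hβ.continuousAt
  have hBm : Monotone B := monotone_of_hasDerivAt_nonneg hBd hβ0
  have hBl : B l = 0 := by simp [hB]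
  -- Subtracting the primitive of the forcing leaves a function with derivative at most `K * m`,
  -- where `m` is the maximum of `‖Y‖`; over the short interval it moves by at most `m / 4`.
  set Z : ℝ → E := fun x => Y x - (A * B x) • e with hZ
  have hZd : ∀ x ∈ Icc l r, HasDerivAt Z (Y' x - (A * β x) • e) x := fun x hx =>
    (hY x hx).sub (((hBd x).const_mul A).smul_const e)
  obtain ⟨x₀, hx₀, hmax⟩ := isCompact_Icc.exists_isMaxOn (nonempty_Icc.2 hlr)
    (f := fun x => ‖Y x‖) (fun x hx => (hY x hx).continuousAt.continuousWithinAt.norm)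
  set m := ‖Y x₀‖ with hm
  have hm0 : 0 ≤ m := norm_nonneg _
  have hmv : ∀ x ∈ Icc l r, ‖Z x - Z l‖ ≤ 1 / 4 * m := by
    intro x hx
    have h := (convex_Icc l r).norm_image_sub_le_of_norm_hasDerivWithin_le (C := K * m)
      (fun x hx => (hZd x hx).hasDerivWithinAt)
      (fun x hx => (hK x hx).trans (mul_le_mul_of_nonneg_left (hmax hx) hK0))
      (left_mem_Icc.2 hlr) hx
    refine h.trans ?_
    have h1 : ‖x - l‖ ≤ r - l := by
      rw [Real.norm_eq_abs, abs_of_nonneg (by linarith [hx.1])]; linarith [hx.2]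
    calc K * m * ‖x - l‖ ≤ K * m * (r - l) := by gcongr
      _ = K * (r - l) * m := by ring
      _ ≤ _ := by gcongr
  have hsm : ∀ x ∈ Icc l r, ‖(A * B x) • e‖ = |A| * B x := by
    intro x hx
    have : 0 ≤ B x := hBl ▸ hBm hx.1
    rw [norm_smul, he, mul_one, Real.norm_eq_abs, abs_mul, abs_of_nonneg this]
  have hZl : Z l = Y l := by simp [hZ, hBl]
  have h1 : m ≤ 1 / 4 * m + ‖Y l‖ + |A| * B r := by
    have e1 : Y x₀ = (Z x₀ - Z l) + Y l + (A * B x₀) • e := by rw [hZl]; simp [hZ]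
    have := norm_add₃_le (a := Z x₀ - Z l) (b := Y l) (c := (A * B x₀) • e)
    rw [← e1, hsm x₀ hx₀] at this
    have h2 : |A| * B x₀ ≤ |A| * B r := by gcongr; exact hBm hx₀.2
    linarith [hmv x₀ hx₀]
  have h2 : |A| * B r ≤ ‖Y r‖ + 1 / 4 * m + ‖Y l‖ := by
    have hr := right_mem_Icc.2 hlr
    have e1 : (A * B r) • e = Y r - (Z r - Z l) - Y l := by rw [hZl]; simp only [hZ]; abel
    rw [← hsm r hr, e1]
    refine (norm_sub_le _ _).trans ?_
    have := norm_sub_le (Y r) (Z r - Z l)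
    linarith [hmv r hr]
  change |A| * B r ≤ _
  linarith [norm_nonneg (Y r), norm_nonneg (Y l)]

/-- A solution of a linear system driven by a bump `A β` with short support controls the amplitude
`A` by its values at the ends of any larger interval. -/
lemma abs_mul_integral_le {Y Y' : ℝ → E} {e : E} (he : ‖e‖ = 1) {β : ℝ → ℝ}
    (hβ : Continuous β) (hβ0 : ∀ x, 0 ≤ β x) {A K a b l r : ℝ} (hal : a ≤ l) (hlr : l ≤ r)
    (hrb : r ≤ b) (hK0 : 0 ≤ K) (hsmall : K * (r - l) ≤ 1 / 4)
    (hsupp : ∀ x, x ≤ l ∨ r ≤ x → β x = 0)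
    (hY : ∀ x ∈ Icc a b, HasDerivAt Y (Y' x) x)
    (hK : ∀ x ∈ Icc a b, ‖Y' x - (A * β x) • e‖ ≤ K * ‖Y x‖) :
    |A| * (∫ x in l..r, β x) ≤ 2 * Real.exp (K * (b - a)) * (‖Y a‖ + ‖Y b‖) := by
  have h0 := abs_mul_integral_le_of_short he hβ hβ0 hlr hK0 hsmall
    (fun x hx => hY x ⟨hal.trans hx.1, hx.2.trans hrb⟩)
    (fun x hx => hK x ⟨hal.trans hx.1, hx.2.trans hrb⟩)
  -- Off the support of `β` the system is homogeneous, so Gronwall carries the values at `l` and `r`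
  -- out to `a` and `b`.
  have h1 := norm_le_exp_of_norm_deriv_le (Y := Y) (Y' := Y') (a := a) (b := l) (K := K)
    (fun x hx => hY x ⟨hx.1, hx.2.trans (hlr.trans hrb)⟩)
    (fun x hx => by
      simpa [hsupp x (Or.inl hx.2)] using hK x ⟨hx.1, hx.2.trans (hlr.trans hrb)⟩) hal
  have h2 := norm_le_exp_of_norm_deriv_le_reverse (Y := Y) (Y' := Y') (a := r) (b := b) (K := K)
    (fun x hx => hY x ⟨(hal.trans hlr).trans hx.1, hx.2⟩)
    (fun x hx => by
      simpa [hsupp x (Or.inr hx.1)] using hK x ⟨(hal.trans hlr).trans hx.1, hx.2⟩) hrb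
  have e1 : Real.exp (K * (l - a)) ≤ Real.exp (K * (b - a)) := by gcongr; linarith
  have e2 : Real.exp (K * (b - r)) ≤ Real.exp (K * (b - a)) := by gcongr; linarith
  have f1 := mul_le_mul_of_nonneg_left e1 (norm_nonneg (Y a))
  have f2 := mul_le_mul_of_nonneg_left e2 (norm_nonneg (Y b))
  linarith

end Estimates

lemma hasDerivAt_iteratedDeriv {u : ℝ → ℝ} {x : ℝ} {p i : ℕ} (hu : ContDiffAt ℝ p u x)
    (hi : i < p) : HasDerivAt (iteratedDeriv i u) (iteratedDeriv (i + 1) u x) x := by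
  rw [iteratedDeriv_succ]
  have h1 : ContDiffAt ℝ 1 (iteratedFDeriv ℝ i u) x :=
    hu.iteratedFDeriv_right (by exact_mod_cast (by omega : 1 + i ≤ p))
  have h2 : DifferentiableAt ℝ (iteratedDeriv i u) x := by
    rw [iteratedDeriv_eq_equiv_comp]
    exact ((ContinuousMultilinearMap.piFieldEquiv ℝ (Fin i) ℝ).symm.differentiableAt).comp x
      (h1.differentiableAt (by simp))
  exact h2.hasDerivAt

/-! ### Locally finite sums of bumps -/

/-- The linear map `a ↦ ∑ₙ aₙ fₙ` defined by a locally finite family of continuous functions. -/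
def locallyFiniteSum {X : Type*} [TopologicalSpace X] (f : ℕ → C(X, ℝ))
    (hf : LocallyFinite fun n => Function.support (f n)) : (ℕ → ℝ) →ₗ[ℝ] C(X, ℝ) where
  toFun a := ⟨fun x => ∑ᶠ n, a n * f n x, continuous_finsum
    (fun n => continuous_const.mul (f n).continuous)
    (hf.subset fun n => Function.support_mul_subset_right _ _)⟩
  map_add' a b := by
    ext x
    have hx : ∀ a : ℕ → ℝ, (Function.support fun n => a n * f n x).Finite := fun a =>
      (hf.point_finite x).subset fun n hn => right_ne_zero_of_mul hn
    simp only [ContinuousMap.coe_mk, ContinuousMap.add_apply, Pi.add_apply, add_mul]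
    exact finsum_add_distrib (hx a) (hx b)
  map_smul' c a := by
    ext x
    simp only [ContinuousMap.coe_mk, ContinuousMap.smul_apply, Pi.smul_apply, smul_eq_mul,
      RingHom.id_apply, mul_assoc]
    exact (mul_finsum _ _).symm

/-- The tent function of height one and radius `ρ` about `w`. -/
def tent (w : ℝ × ℝ) (ρ : ℝ) (z : ℝ × ℝ) : ℝ := max 0 (1 - dist z w / ρ)

lemma continuous_tent (w : ℝ × ℝ) (ρ : ℝ) : Continuous (tent w ρ) := by
  unfold tent
  fun_prop

lemma tent_nonneg (w : ℝ × ℝ) (ρ : ℝ) (z : ℝ × ℝ) : 0 ≤ tent w ρ z := le_max_left _ _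

lemma tent_eq_zero {w z : ℝ × ℝ} {ρ : ℝ} (hρ : 0 < ρ) (h : ρ ≤ dist z w) : tent w ρ z = 0 :=
  max_eq_left (sub_nonpos.2 ((one_le_div hρ).2 h))

lemma tent_pos {w z : ℝ × ℝ} {ρ : ℝ} (hρ : 0 < ρ) (h : dist z w < ρ) : 0 < tent w ρ z :=
  lt_max_of_lt_right (sub_pos.2 ((div_lt_one hρ).2 h))

/-- Each point of `Ω` is at positive distance from `v`, while the supports shrink to `v`. This
permits arbitrary amplitudes. -/
lemma locallyFinite_support_tent {Ω : Set (ℝ × ℝ)} {w : ℕ → ℝ × ℝ} {ρ : ℕ → ℝ} {v : ℝ × ℝ}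
    (hv : v ∉ Ω) (hw : Tendsto w atTop (𝓝 v)) (hρ : ∀ n, 0 < ρ n)
    (hρ0 : Tendsto ρ atTop (𝓝 0)) :
    LocallyFinite fun n => Function.support fun z : Ω => tent (w n) (ρ n) z := by
  intro z
  have hd : 0 < dist (z : ℝ × ℝ) v := dist_pos.2 fun h => hv (h ▸ z.2)
  refine ⟨Metric.ball z (dist (z : ℝ × ℝ) v / 3), Metric.ball_mem_nhds _ (by positivity), ?_⟩
  have h1 : ∀ᶠ n in atTop, dist (w n) v < dist (z : ℝ × ℝ) v / 3 :=
    hw (Metric.ball_mem_nhds _ (by positivity))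
  have h2 : ∀ᶠ n in atTop, ρ n < dist (z : ℝ × ℝ) v / 3 := hρ0.eventually_lt_const (by positivity)
  rw [← Nat.cofinite_eq_atTop] at h1 h2
  refine (h1.and h2).subset ?_
  rintro n ⟨y, hy, hyz⟩ ⟨h3, h4⟩
  refine hy (tent_eq_zero (hρ n) ?_)
  have h5 : dist (y : ℝ × ℝ) z < dist (z : ℝ × ℝ) v / 3 := hyz
  have h6 := dist_triangle4 (z : ℝ × ℝ) y (w n) v
  rw [dist_comm (z : ℝ × ℝ) y] at h6
  linarith

/-- The halving of distances to `t` keeps later bumps off the vertical lines of the others. -/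
lemma exists_seq_of_frequently {t : ℝ} {p : ℝ → Prop} (h : ∃ᶠ s in 𝓝[≠] t, p s) :
    ∃ τ : ℕ → ℝ, (∀ n, τ n ≠ t ∧ p (τ n)) ∧ Tendsto τ atTop (𝓝 t) ∧
      ∀ m n, m < n → |τ n - t| ≤ |τ m - t| / 2 := by
  have hstep : ∀ δ : ℝ, 0 < δ → ∃ s, (s ≠ t ∧ p s) ∧ |s - t| < δ := by
    intro δ hδ
    have := (frequently_nhdsWithin_iff.1 h).and_eventually (Metric.ball_mem_nhds t hδ)
    obtain ⟨s, ⟨h1, h2⟩, h3⟩ := this.exists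
    exact ⟨s, ⟨h2, h1⟩, h3⟩
  have hnext : ∀ s : {s // s ≠ t ∧ p s}, ∃ s' : {s // s ≠ t ∧ p s},
      |(s' : ℝ) - t| ≤ |(s : ℝ) - t| / 2 := fun s =>
    let ⟨s', h', hlt⟩ := hstep (|(s : ℝ) - t| / 2) (half_pos (abs_pos.2 (sub_ne_zero.2 s.2.1)))
    ⟨⟨s', h'⟩, hlt.le⟩
  choose next hnext using hnext
  obtain ⟨s₀, hs₀, -⟩ := hstep 1 one_pos
  set τ : ℕ → {s // s ≠ t ∧ p s} := fun n => next^[n] ⟨s₀, hs₀⟩ with hτ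
  have hsucc : ∀ n, |(τ (n + 1) : ℝ) - t| ≤ |(τ n : ℝ) - t| / 2 := fun n => by
    simp only [hτ, Function.iterate_succ_apply']
    exact hnext _
  have hanti : Antitone fun n => |(τ n : ℝ) - t| := antitone_nat_of_succ_le fun n =>
    (hsucc n).trans (half_le_self (abs_nonneg _))
  refine ⟨fun n => τ n, fun n => (τ n).2, ?_, fun m n hmn => (hanti hmn).trans (hsucc m)⟩
  have hgeom : ∀ n, |(τ n : ℝ) - t| ≤ |(τ 0 : ℝ) - t| * (1 / 2) ^ n := by
    intro n
    induction n with
    | zero => simp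
    | succ n ih => rw [pow_succ]; linarith [hsucc n]
  rw [tendsto_iff_norm_sub_tendsto_zero]
  refine squeeze_zero (fun _ => norm_nonneg _) hgeom ?_
  simpa using (tendsto_pow_atTop_nhds_zero_of_lt_one (r := (1 / 2 : ℝ)) (by norm_num)
    (by norm_num)).const_mul (|(τ 0 : ℝ) - t|)

/-! ### The operator on a vertical segment -/

variable {Ω : Set (ℝ × ℝ)}

lemma DO.toLinearMap_apply (P : DO Ω) (u : Cx P.ord Ω) (z : Ω) :
    P.toLinearMap u z = ∑ i, P.coeff i z * xDerivAt i u.1 z := by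
  simp [DO.toLinearMap, xDeriv, ContinuousMap.sum_apply]

/-- The vector of the derivatives of `v` of orders less than `p`. -/
def jet (p : ℕ) (v : ℝ → ℝ) (x : ℝ) : Fin p → ℝ := fun i => iteratedDeriv i v x

/-- The vector of the derivatives of `v` of orders `1, …, p`. -/
def jetDeriv (p : ℕ) (v : ℝ → ℝ) (x : ℝ) : Fin p → ℝ := fun i => iteratedDeriv (i + 1) v x

lemma hasDerivAt_jet {p : ℕ} {v : ℝ → ℝ} {x : ℝ} (hv : ContDiffAt ℝ p v x) :
    HasDerivAt (jet p v) (jetDeriv p v x) x :=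
  hasDerivAt_pi.2 fun i => hasDerivAt_iteratedDeriv hv i.2

/-- On a vertical segment in `Ω`, the equation `P u = gᵖ F` is a linear first order system for the
jet of `u` with bounded coefficients and right-hand side `F`. -/
lemma DO.exists_norm_jetDeriv_sub_le (P : DO Ω) (hP : 1 ≤ P.ord) {t a b : ℝ}
    (hseg : ∀ x ∈ Icc a b, (t, x) ∈ Ω) :
    ∃ K : ℝ, 0 ≤ K ∧ ∀ (u : Cx P.ord Ω) (F : C(Ω, ℝ)),
      P.toLinearMap u = P.coeff (Fin.last P.ord) * F →
      ∀ x (hx : x ∈ Icc a b), ‖jetDeriv P.ord (slice u.1 t) x -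
        F ⟨(t, x), hseg x hx⟩ • (Pi.single ⟨P.ord - 1, Nat.sub_lt hP one_pos⟩ 1 : Fin P.ord → ℝ)‖ ≤
          K * ‖jet P.ord (slice u.1 t) x‖ := by
  set q : Icc a b → ℝ := fun x => ∑ i : Fin P.ord,
    |P.coeff i.castSucc ⟨(t, x), hseg x x.2⟩ / P.coeff (Fin.last P.ord) ⟨(t, x), hseg x x.2⟩|
    with hq
  have hι : Continuous fun x : Icc a b => (⟨(t, x), hseg x x.2⟩ : Ω) := by fun_prop
  have hqc : Continuous q := by
    refine continuous_finsetSum _ fun i _ => Continuous.abs (Continuous.div ?_ ?_ ?_)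
    · exact (P.coeff _).continuous.comp hι
    · exact (P.coeff _).continuous.comp hι
    · exact fun x => P.lcoef_ne_zero _
  obtain ⟨C, hC⟩ := isCompact_univ.bddAbove_image hqc.continuousOn
  -- The `1` serves the rows that merely shift the jet, and `C` the last row, which contains the
  -- equation divided by `gᵖ`.
  refine ⟨max 1 C, le_max_of_le_left zero_le_one, fun u F hu x hx => ?_⟩
  set z : Ω := ⟨(t, x), hseg x hx⟩ with hz
  set Y := jet P.ord (slice u.1 t) x with hY
  have hqx : q ⟨x, hx⟩ ≤ C := hC ⟨⟨x, hx⟩, mem_univ _, rfl⟩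
  have h0 : 0 ≤ max 1 C := le_max_of_le_left zero_le_one
  refine (pi_norm_le_iff_of_nonneg (by positivity)).2 fun i => ?_
  by_cases hi : (i : ℕ) + 1 = P.ord
  · obtain rfl : i = ⟨P.ord - 1, Nat.sub_lt hP one_pos⟩ := Fin.ext (by simp; omega)
    have heq : P.toLinearMap u z = P.coeff (Fin.last P.ord) z * F z := by rw [hu]; rfl
    rw [DO.toLinearMap_apply, Fin.sum_univ_castSucc] at heq
    have hne := P.lcoef_ne_zero z
    have hval : xDerivAt P.ord u.1 z - F z =
        -∑ j : Fin P.ord, P.coeff j.castSucc z / P.coeff (Fin.last P.ord) z * Y j := by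
      have e1 : ∑ j : Fin P.ord, P.coeff j.castSucc z / P.coeff (Fin.last P.ord) z * Y j =
          (∑ j : Fin P.ord, P.coeff j.castSucc z * xDerivAt (j.castSucc : Fin (P.ord + 1)) u.1 z)
            / P.coeff (Fin.last P.ord) z := by
        rw [Finset.sum_div]
        refine Finset.sum_congr rfl fun j _ => ?_
        rw [div_mul_eq_mul_div]
        rfl
      rw [e1]
      field_simp
      simp only [Fin.val_last] at heq
      linear_combination heq
    have hcomp : (jetDeriv P.ord (slice u.1 t) x -
        F z • (Pi.single ⟨P.ord - 1, Nat.sub_lt hP one_pos⟩ 1 : Fin P.ord → ℝ))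
          ⟨P.ord - 1, Nat.sub_lt hP one_pos⟩ =
        xDerivAt P.ord u.1 z - F z := by
      simp [jetDeriv, xDerivAt, hz, Nat.sub_add_cancel hP]
    rw [hcomp, hval, norm_neg]
    calc _ ≤ ∑ j : Fin P.ord, ‖P.coeff j.castSucc z / P.coeff (Fin.last P.ord) z * Y j‖ :=
          norm_sum_le _ _
      _ ≤ ∑ j : Fin P.ord, |P.coeff j.castSucc z / P.coeff (Fin.last P.ord) z| * ‖Y‖ := by
          refine Finset.sum_le_sum fun j _ => ?_
          rw [norm_mul]
          exact mul_le_mul_of_nonneg_left (norm_le_pi_norm Y j) (abs_nonneg _)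
      _ = q ⟨x, hx⟩ * ‖Y‖ := by rw [← Finset.sum_mul]
      _ ≤ max 1 C * ‖Y‖ := by gcongr; exact hqx.trans (le_max_right _ _)
  · have hlt : (i : ℕ) + 1 < P.ord := by omega
    have hcomp : (jetDeriv P.ord (slice u.1 t) x -
        F z • (Pi.single ⟨P.ord - 1, Nat.sub_lt hP one_pos⟩ 1 : Fin P.ord → ℝ)) i =
          Y ⟨i + 1, hlt⟩ := by
      have hi' : i ≠ ⟨P.ord - 1, Nat.sub_lt hP one_pos⟩ := fun h => hi (by rw [h]; simp; omega)
      simp [jetDeriv, hY, jet, hi']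
    rw [hcomp]
    calc _ ≤ ‖Y‖ := norm_le_pi_norm Y _
      _ ≤ max 1 C * ‖Y‖ := le_mul_of_one_le_left (norm_nonneg _) (le_max_left _ _)

/-- The derivatives of `u` are continuous in both variables, so the jets converge to the jet at `(t,
a)`. -/
lemma exists_norm_jet_le {p : ℕ} (u : Cx p Ω) {τ : ℕ → ℝ} {t a : ℝ} (ht : (t, a) ∈ Ω)
    (hτ : Tendsto τ atTop (𝓝 t)) (hmem : ∀ n, (τ n, a) ∈ Ω) :
    ∃ C, ∀ n, ‖jet p (slice u.1 (τ n)) a‖ ≤ C := by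
  have h1 : Tendsto (fun n => (⟨(τ n, a), hmem n⟩ : Ω)) atTop (𝓝 ⟨(t, a), ht⟩) :=
    tendsto_subtype_rng.2 (hτ.prodMk_nhds tendsto_const_nhds)
  have h2 : Tendsto (fun n => jet p (slice u.1 (τ n)) a) atTop (𝓝 (jet p (slice u.1 t) a)) :=
    tendsto_pi_nhds.2 fun i => ((u.2.2 i i.2.le).tendsto _).comp h1
  obtain ⟨C, hC⟩ := h2.norm.bddAbove_range
  exact ⟨C, fun n => hC ⟨n, rfl⟩⟩

/-- Sequences embed in `C(Ω)` in such a way that those mapped to the image of `P` have a bounded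
order of growth. -/
lemma DO.exists_linearMap_growth (P : DO Ω) (hP : 1 ≤ P.ord) {t a b c : ℝ} (hac : a < c)
    (hcb : c < b) (hta : (t, a) ∈ Ω) (htb : (t, b) ∈ Ω) (htc : (t, c) ∉ Ω)
    (hfreq : ∃ᶠ s in 𝓝[≠] t, ∀ x ∈ Icc a b, (s, x) ∈ Ω) :
    ∃ (T : (ℕ → ℝ) →ₗ[ℝ] C(Ω, ℝ)) (S : ℕ → ℝ), (∀ n, 0 < S n) ∧
      ∀ α, T α ∈ LinearMap.range P.toLinearMap → ∃ C, ∀ n, |α n| ≤ C * S n := by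
  obtain ⟨τ, hτ, hτt, hτd⟩ := exists_seq_of_frequently hfreq
  have hseg : ∀ n, ∀ x ∈ Icc a b, (τ n, x) ∈ Ω := fun n => (hτ n).2
  have hd : ∀ n, 0 < |τ n - t| := fun n => abs_pos.2 (sub_ne_zero.2 (hτ n).1)
  choose K hK0 hK using fun n => P.exists_norm_jetDeriv_sub_le hP (hseg n)
  -- The three bounds keep the bump off the other lines, keep its support within `[a, b]`, and make
  -- `K n * (2 * ρ n) ≤ 1 / 4`.
  set ρ : ℕ → ℝ := fun n =>
    min (|τ n - t| / 2) (min (min (c - a) (b - c)) (1 / (8 * (K n + 1)))) with hρdef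
  have hρ : ∀ n, 0 < ρ n := fun n => by
    have := hK0 n
    have := hd n
    exact lt_min (by positivity) (lt_min (lt_min (by linarith) (by linarith)) (by positivity))
  have hρd : ∀ n, ρ n ≤ |τ n - t| / 2 := fun n => min_le_left _ _
  have hρa : ∀ n, ρ n ≤ c - a := fun n =>
    (min_le_right _ _).trans ((min_le_left _ _).trans (min_le_left _ _))
  have hρb : ∀ n, ρ n ≤ b - c := fun n =>
    (min_le_right _ _).trans ((min_le_left _ _).trans (min_le_right _ _))
  have hρK : ∀ n, K n * ((c + ρ n) - (c - ρ n)) ≤ 1 / 4 := fun n => by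
    have h1 : ρ n ≤ 1 / (8 * (K n + 1)) := (min_le_right _ _).trans (min_le_right _ _)
    have h2 := hK0 n
    rw [le_div_iff₀ (by positivity)] at h1
    nlinarith [hρ n]
  have hρ0 : Tendsto ρ atTop (𝓝 0) := by
    refine squeeze_zero (fun n => (hρ n).le) hρd ?_
    simpa using ((hτt.sub_const t).abs.div_const 2)
  have hfin := locallyFinite_support_tent htc (hτt.prodMk_nhds (tendsto_const_nhds (x := c))) hρ hρ0
  set f : ℕ → C(Ω, ℝ) := fun n => ⟨fun z => tent (τ n, c) (ρ n) z,
    (continuous_tent _ _).comp continuous_subtype_val⟩ with hf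
  set L := locallyFiniteSum f hfin with hL
  have hLval : ∀ α n x (h : (τ n, x) ∈ Ω),
      L α ⟨(τ n, x), h⟩ = α n * tent (τ n, c) (ρ n) (τ n, x) := by
    intro α n x h
    -- Halving gives `|τ n - τ m| ≥ |τ m - t| / 2 ≥ ρ m` for `m ≠ n`, so only the `n`-th bump meets
    -- the line over `τ n`.
    refine finsum_eq_single _ n fun m hm => mul_eq_zero_of_right _ ?_
    refine tent_eq_zero (hρ m) (le_trans ?_ (le_max_left _ _))
    have h1 := hρd m
    have h2 := hd m
    change _ ≤ dist (τ n) (τ m)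
    rw [Real.dist_eq]
    have h3 := abs_sub_abs_le_abs_sub (τ n - t) (τ m - t)
    have h4 := abs_sub_abs_le_abs_sub (τ m - t) (τ n - t)
    rw [sub_sub_sub_cancel_right] at h3 h4
    rw [abs_sub_comm (τ m) (τ n)] at h4
    rcases lt_or_gt_of_ne hm with h | h
    · linarith [hτd m n h]
    · linarith [hτd n m h]
  set β : ℕ → ℝ → ℝ := fun n x => tent (τ n, c) (ρ n) (τ n, x) with hβ
  have hβc : ∀ n, Continuous (β n) := fun n =>
    (continuous_tent _ _).comp (Continuous.prodMk_right _)
  have hdist : ∀ n x, dist (τ n, x) (τ n, c) = |x - c| := fun n x => by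
    rw [Prod.dist_eq, dist_self, Real.dist_eq]
    exact max_eq_right (abs_nonneg _)
  have hβs : ∀ n x, x ≤ c - ρ n ∨ c + ρ n ≤ x → β n x = 0 := fun n x hx => by
    refine tent_eq_zero (hρ n) ?_
    rw [hdist, le_abs]
    rcases hx with h | h
    · right; linarith
    · left; linarith
  have hint : ∀ n, 0 < ∫ x in (c - ρ n)..(c + ρ n), β n x := fun n => by
    refine intervalIntegral.intervalIntegral_pos_of_pos_on ((hβc n).intervalIntegrable _ _)
      (fun x hx => tent_pos (hρ n) ?_) (by linarith [hρ n])
    rw [hdist, abs_lt]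
    exact ⟨by linarith [hx.1], by linarith [hx.2]⟩
  refine ⟨LinearMap.mulLeft ℝ (P.coeff (Fin.last P.ord)) ∘ₗ L,
    fun n => 2 * Real.exp (K n * (b - a)) / ∫ x in (c - ρ n)..(c + ρ n), β n x,
    fun n => div_pos (by positivity) (hint n), ?_⟩
  rintro α ⟨u, hu⟩
  obtain ⟨C₁, hC₁⟩ := exists_norm_jet_le u hta hτt fun n => hseg n a ⟨le_rfl, (hac.trans hcb).le⟩
  obtain ⟨C₂, hC₂⟩ := exists_norm_jet_le u htb hτt fun n => hseg n b ⟨(hac.trans hcb).le, le_rfl⟩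
  refine ⟨C₁ + C₂, fun n => ?_⟩
  rw [mul_div_assoc', le_div_iff₀ (hint n)]
  have he : ‖(Pi.single ⟨P.ord - 1, Nat.sub_lt hP one_pos⟩ 1 : Fin P.ord → ℝ)‖ = 1 := by
    rw [Pi.norm_single, norm_one]
  have hest := abs_mul_integral_le (Y := jet P.ord (slice u.1 (τ n)))
    (Y' := jetDeriv P.ord (slice u.1 (τ n)))
    he
    (hβc n) (fun x => tent_nonneg _ _ _) (A := α n) (a := a) (b := b)
    (by linarith [hρa n]) (by linarith [hρ n]) (by linarith [hρb n]) (hK0 n) (hρK n) (hβs n)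
    (fun x hx => hasDerivAt_jet (u.2.1 ⟨(τ n, x), hseg n x hx⟩))
    (fun x hx => by
      have := hK n u (L α) hu x hx
      rwa [hLval] at this)
  refine hest.trans ?_
  rw [mul_comm (C₁ + C₂)]
  gcongr
  · exact hC₁ n
  · exact hC₂ n

/-- A space to which sequences map so that those landing in `R` have bounded order of growth is
infinite-dimensional modulo `R`. -/
lemma not_finiteDimensional_quotient_of_growth {V : Type*} [AddCommGroup V] [Module ℝ V]
    (R : Submodule ℝ V) (T : (ℕ → ℝ) →ₗ[ℝ] V) (S : ℕ → ℝ) (hS : ∀ n, 0 < S n)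
    (hT : ∀ α, T α ∈ R → ∃ C, ∀ n, |α n| ≤ C * S n) : ¬ FiniteDimensional ℝ (V ⧸ R) := by
  intro hfin
  -- The factor `X` makes every nonzero `q`, constants included, outgrow all multiples of `S`.
  let ev : Polynomial ℝ →ₗ[ℝ] (ℕ → ℝ) :=
    { toFun := fun q n => S n * (Polynomial.X * q).eval (n : ℝ)
      map_add' := fun q r => by ext n; simp [mul_add]
      map_smul' := fun k q => by ext n; simp; ring }
  refine Polynomial.not_finite (R := ℝ)
    (Module.Finite.of_injective (R.mkQ ∘ₗ T ∘ₗ ev) ((injective_iff_map_eq_zero _).2 ?_))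
  intro q hq
  by_contra hq0
  obtain ⟨C, hC⟩ := hT (ev q) ((Submodule.Quotient.mk_eq_zero R).1 hq)
  have hdeg : 0 < (Polynomial.X * q).degree := by
    rw [Polynomial.degree_mul, Polynomial.degree_X, Polynomial.degree_eq_natDegree hq0]
    exact_mod_cast Nat.add_pos_left one_pos _
  have hlim := ((Polynomial.X * q).abs_tendsto_atTop hdeg).comp
    (tendsto_natCast_atTop_atTop (R := ℝ))
  obtain ⟨n, hn⟩ := (hlim.eventually_gt_atTop C).exists
  have h := hC n
  change |S n * _| ≤ _ at h
  rw [abs_mul, abs_of_pos (hS n), mul_comm] at h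
  exact absurd (le_of_mul_le_mul_right h (hS n)) (not_le.2 hn)

end ParamODE

end

theorem mainTheorem5 (Ω : Set (ℝ × ℝ)) (hΩ : IsOpen Ω)
    (hcomp : ∃ z ∈ Ω, ¬ ParamODE.IsXSimple (connectedComponentIn Ω z))
    (P : ParamODE.DO Ω) (hP : 1 ≤ P.ord) :
    ¬ FiniteDimensional ℝ (C(Ω, ℝ) ⧸ LinearMap.range P.toLinearMap) := by
  obtain ⟨t, a, b, c, hac, hcb, hta, htb, htc, hfreq⟩ := ParamODE.exists_vertical_gap hΩ hcomp
  obtain ⟨T, S, hS, hT⟩ := P.exists_linearMap_growth hP hac hcb hta htb htc hfreq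
  exact ParamODE.not_finiteDimensional_quotient_of_growth _ T S hS hT
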